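/- Let $M,N\ge 1$ be integers, $L>0$, $h=L/N$; let $q_1,\dots,q_M$ be nonzero reals and $N_1,\dots,N_M$ positive reals. All grid functions are real and periodic with period $N$ in each of the indices $i,j,k\in\mathbb Z$. Let $\varepsilon=(\varepsilon_{i,j,k})$ be a positive grid function with edge values $\varepsilon_{i+1/2,j,k}=\frac12(\varepsilon_{i,j,k}+\varepsilon_{i+1,j,k})$, and similarly $\varepsilon_{i,j+1/2,k}$, $\varepsilon_{i,j,k+1/2}$; let $\rho^h$ be a grid function with $\sum_{s=1}^M q_sN_s+h^3\sum_{i,j,k=0}^{N-1}\rho^h_{i,j,k}=0$. Let $X_{\rho,h}$ be the set of all $(c,D)=(c_1,\dots,c_M;u,v,w)$, where each concentration $c_s$ is a grid function and the displacement $D=(u,v,w)$ has periodic components $u_{i+1/2,j,k}$, $v_{i,j+1/2,k}$, $w_{i,j,k+1/2}$ at the midpoints of the grid edges, such that $$c_s\ge 0,\qquad h^3\sum_{i,j,k=0}^{N-1}c_{s,i,j,k}=N_s\qquad(1\le s\le M),$$ $$\frac1h\left(u_{i+1/2,j,k}-u_{i-1/2,j,k}+v_{i,j+1/2,k}-v_{i,j-1/2,k}+w_{i,j,k+1/2}-w_{i,j,k-1/2}\right)=\rho^h_{i,j,k}+\sum_{s=1}^M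 q_sc_{s,i,j,k}\qquad\forall\, i,j,k .$$ The discrete Poisson--Boltzmann energy is, with $0\log 0=0$, $$\hat F_h[c,D]=\frac{h^3}{2}\sum_{i,j,k=0}^{N-1}\left(\frac{u_{i+1/2,j,k}^2}{\varepsilon_{i+1/2,j,k}}+\frac{v_{i,j+1/2,k}^2}{\varepsilon_{i,j+1/2,k}}+\frac{w_{i,j,k+1/2}^2}{\varepsilon_{i,j,k+1/2}}\right)+h^3\sum_{s=1}^M\sum_{i,j,k=0}^{N-1}c_{s,i,j,k}\log c_{s,i,j,k}.$$ Local algorithm. Let $(c,D)\in X_{\rho,h}$ have positive concentrations. The local update for the species $s$ and the edge from $(i,j,k)$ to $(i+1,j,k)$ subtracts $\zeta$ from $c_{s,i,j,k}$, adds $\zeta$ to $c_{s,i+1,j,k}$, and replaces $u_{i+1/2,j,k}$ by $u_{i+1/2,j,k}-hq_s\zeta$ (with the corresponding periodic values), where $\zeta$ is the unique solution in $(-c_{s,i+1,j,k},\,c_{s,i,j,k})$ of $$\log(c_{s,i+1,j,k}+\zeta)-\log(c_{s,i,j,k}-\zeta)-\frac{hq_s}{\varepsilon_{i+1/2,j,k}}\left(u_{i+1/2,j,k}-hq_s\zeta\right)=0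 .$$ The updates for edges in the second and third directions, with $v$ and $w$, are analogous. One sweep performs, for $i,j,k=0,\dots,N-1$ (nested loops in this order) and at each $(i,j,k)$ for the edges to $(i+1,j,k)$, $(i,j+1,k)$, $(i,j,k+1)$ in this order, the updates for $s=1,\dots,M$, each update starting from the result of the preceding one. Starting from $(c^{(0)},D^{(0)})$, the algorithm stops with last state $(c^{(m)},D^{(m)})$ if no local update of this state decreases the energy; otherwise $(c^{(m+1)},D^{(m+1)})$ is obtained from $(c^{(m)},D^{(m)})$ by one sweep. Theorem. The functional $\hat F_h:X_{\rho,h}\to\mathbb R$ has a unique minimizer $(\hat c^h_{\min},\hat D^h_{\min})$. Let $(c^{(0)},D^{(0)})\in X_{\rho,h}$ with $c^{(0)}_s>0$ at all grid points for all $s$. Then the local algorithm generates a sequence $(c^{(t)},D^{(t)})$, $t=0,1,\dots$ (finite or infinite), in $X_{\rho,h}$ with positive concentrations, and: (1) if the sequence is finite with last member $(c^{(m)},D^{(m)})$, then $(c^{(m)},D^{(m)})=(\hat c^h_{\min},\hat D^h_{\min})$; (2) if the sequence is infinite, then $$\lim_{t\to\infty}(c^{(t)},D^{(t)})=(\hat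 c^h_{\min},\hat D^h_{\min})\quad\text{and}\quad\lim_{t\to\infty}\hat F_h[c^{(t)},D^{(t)}]=\hat F_h[\hat c^h_{\min},\hat D^h_{\min}].$$ -/

import Mathlib

/-! Discrete Poisson-Boltzmann (PB) energy on a periodic cubic grid and the local algorithm
that minimizes it by transferring ions along the grid edges. -/

open Filter Topology

noncomputable section

namespace PBLocal

/-- Grid points of the period cell: the point `(ih, jh, kh)` is given by the residues of
`i, j, k` modulo `N`, so a real function on `Grid N` is a periodic grid function. -/
abbrev Grid (N : ℕ) : Type := Fin 3 → ZMod N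

/-- The unit step in the coordinate direction `a`. -/
def step {N : ℕ} (a : Fin 3) : Grid N := Pi.single a 1

/-- Concentrations and displacement `(c, D)`. Here `x.1 s p` is the concentration of the species
`s` at the point `p`, and `x.2 a p` is the component of the displacement at the midpoint of the
edge from `p` to `p + step a`: with `p = (i, j, k)`, the numbers `x.2 0 p`, `x.2 1 p`, `x.2 2 p`
are `u (i+1/2, j, k)`, `v (i, j+1/2, k)`, `w (i, j, k+1/2)`. -/
abbrev State (M N : ℕ) : Type := (Fin M → Grid N → ℝ) × (Fin 3 → Grid N → ℝ)

/-- The data of the problem with `M` species on a grid with `N` points per direction: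
the side `L` of the cell, the charges `q`, the total amounts `mass` of the species,
the dielectric coefficient `eps`, and the fixed charge density `rho`. -/
structure Data (M N : ℕ) where
  L : ℝ
  q : Fin M → ℝ
  mass : Fin M → ℝ
  eps : Grid N → ℝ
  rho : Grid N → ℝ

variable {M N : ℕ}

/-- The grid size `h = L / N`. -/
def Data.h (P : Data M N) : ℝ := P.L / N

/-- The dielectric coefficient at the midpoint of the edge from `p` to `p + step a`. -/
def Data.edgeEps (P : Data M N) (a : Fin 3) (p : Grid N) : ℝ :=
  (P.eps p + P.eps (p + step a)) / 2

/-- Discrete charge neutrality. -/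
def Data.Neutral [NeZero N] (P : Data M N) : Prop :=
  ∑ s, P.q s * P.mass s + P.h ^ 3 * ∑ p, P.rho p = 0

/-- The discrete divergence of a displacement. -/
def Data.div (P : Data M N) (D : Fin 3 → Grid N → ℝ) (p : Grid N) : ℝ :=
  (1 / P.h) * ∑ a, (D a p - D a (p - step a))

/-- The admissible set `X_{ρ,h}`: nonnegativity, conservation of mass, Gauss' law. -/
def Data.X [NeZero N] (P : Data M N) : Set (State M N) :=
  {x | (∀ s p, 0 ≤ x.1 s p) ∧ (∀ s, P.h ^ 3 * ∑ p, x.1 s p = P.mass s) ∧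
    ∀ p, P.div x.2 p = P.rho p + ∑ s, P.q s * x.1 s p}

/-- The discrete PB energy (with `0 log 0 = 0`). -/
def Data.energy [NeZero N] (P : Data M N) (x : State M N) : ℝ :=
  (1 / 2) * (P.h ^ 3 * ∑ p, ∑ a, x.2 a p ^ 2 / P.edgeEps a p)
    + P.h ^ 3 * ∑ s, ∑ p, x.1 s p * Real.log (x.1 s p)

/-- `ζ` is the optimal amount of ions of charge `q` to be moved along an edge of length `h` with
dielectric coefficient `e`, displacement `γ`, and concentrations `α`, `β` at its initial and
terminal points: it lies in `(-β, α)` and is a critical point of the energy change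
`h³ [(α-ζ) log (α-ζ) + (β+ζ) log (β+ζ) - α log α - β log β + ((γ - hqζ)² - γ²) / (2e)]`. -/
def IsTransfer (h q e α β γ ζ : ℝ) : Prop :=
  ζ ∈ Set.Ioo (-β) α ∧
    Real.log (β + ζ) - Real.log (α - ζ) - h * q / e * (γ - h * q * ζ) = 0

/-- There is exactly one optimal amount when both concentrations are positive. -/
theorem existsUnique_isTransfer (h q : ℝ) {e α β : ℝ} (γ : ℝ) (he : 0 < e) (hα : 0 < α)
    (hβ : 0 < β) : ∃! ζ, IsTransfer h q e α β γ ζ := by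
  have hex : ∃ ζ, IsTransfer h q e α β γ ζ := by
    let g : ℝ → ℝ := fun ζ => (β + ζ) - (α - ζ) * Real.exp (h * q / e * (γ - h * q * ζ))
    have hg : ContinuousOn g (Set.Icc (-β) α) := by
      apply Continuous.continuousOn
      fun_prop
    have hlow : g (-β) < 0 := by
      have := Real.exp_pos (h * q / e * (γ - h * q * (-β)))
      have h2 : 0 < (α - -β) * Real.exp (h * q / e * (γ - h * q * (-β))) :=
        mul_pos (by linarith) this
      simp only [g]
      linarith
    have hhigh : 0 < g α := by
      simp only [g, sub_self, zero_mul, sub_zero]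
      linarith
    obtain ⟨ζ, hζ, hz⟩ := intermediate_value_Ioo (by linarith : -β ≤ α) hg ⟨hlow, hhigh⟩
    refine ⟨ζ, hζ, ?_⟩
    have h1 : 0 < α - ζ := by linarith [hζ.2]
    have h3 : β + ζ = (α - ζ) * Real.exp (h * q / e * (γ - h * q * ζ)) := by
      simp only [g] at hz
      linarith
    rw [h3, Real.log_mul h1.ne' (Real.exp_pos _).ne', Real.log_exp]
    ring
  obtain ⟨ζ, hζ⟩ := hex
  have key : ∀ x y, IsTransfer h q e α β γ x → IsTransfer h q e α β γ y → ¬ x < y := by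
    intro x y hx hy hxy
    have l1 : Real.log (β + x) < Real.log (β + y) :=
      Real.log_lt_log (by linarith [hx.1.1]) (by linarith)
    have l2 : Real.log (α - y) < Real.log (α - x) :=
      Real.log_lt_log (by linarith [hy.1.2]) (by linarith)
    have l3 : 0 ≤ (h * q) ^ 2 / e * (y - x) :=
      mul_nonneg (div_nonneg (sq_nonneg _) he.le) (by linarith)
    have l4 : h * q / e * (γ - h * q * x) - h * q / e * (γ - h * q * y)
        = (h * q) ^ 2 / e * (y - x) := by
      ring
    linarith [hx.2, hy.2]
  refine ⟨ζ, hζ, fun y hy => ?_⟩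
  exact le_antisymm (not_lt.mp (key _ _ hζ hy)) (not_lt.mp (key _ _ hy hζ))

open Classical in
/-- The optimal amount; the value `0` is used only where no optimal amount exists. -/
def transfer (h q e α β γ : ℝ) : ℝ :=
  if hex : ∃ ζ, IsTransfer h q e α β γ ζ then hex.choose else 0

theorem transfer_spec (h q : ℝ) {e α β : ℝ} (γ : ℝ) (he : 0 < e) (hα : 0 < α) (hβ : 0 < β) :
    IsTransfer h q e α β γ (transfer h q e α β γ) := by
  have hex := (existsUnique_isTransfer h q γ he hα hβ).exists
  rw [transfer, dif_pos hex]
  exact hex.choose_spec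

/-- The optimal amount `ζ` of the species `s` to be moved from `p` to `p + step a`. -/
def Data.zeta (P : Data M N) (s : Fin M) (p : Grid N) (a : Fin 3) (x : State M N) : ℝ :=
  transfer P.h (P.q s) (P.edgeEps a p) (x.1 s p) (x.1 s (p + step a)) (x.2 a p)

/-- One local update: move the optimal amount `ζ` of the species `s` from `p` to `p + step a` and
subtract `h q_s ζ` from the displacement on this edge. -/
def Data.update (P : Data M N) (s : Fin M) (p : Grid N) (a : Fin 3) (x : State M N) :
    State M N :=
  (x.1 + Pi.single s (Pi.single (p + step a) (P.zeta s p a x) - Pi.single p (P.zeta s p a x)),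
    x.2 - Pi.single a (Pi.single p (P.h * P.q s * P.zeta s p a x)))

/-- The grid points in the order of the nested loops `i, j, k = 0, …, N - 1`. -/
def gridList (N : ℕ) : List (Grid N) :=
  (List.range N).flatMap fun i => (List.range N).flatMap fun j => (List.range N).map fun k =>
    ![(i : ZMod N), (j : ZMod N), (k : ZMod N)]

/-- The order of the updates in one sweep: over the grid points, at each point over the three
edges in the positive coordinate directions, on each edge over the species. -/
def updateList (M N : ℕ) : List (Grid N × Fin 3 × Fin M) :=
  (gridList N).flatMap fun p => (List.finRange 3).flatMap fun a => (List.finRange M).map fun s =>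
    (p, a, s)

/-- One sweep of the algorithm: all the local updates, one after the other. -/
def Data.sweep (P : Data M N) (x : State M N) : State M N :=
  (updateList M N).foldl (fun y r => P.update r.2.2 r.1 r.2.1 y) x

/-- The stopping criterion: no local update decreases the energy any further. -/
def Data.Stops [NeZero N] (P : Data M N) (x : State M N) : Prop :=
  ∀ s p a, ¬ P.energy (P.update s p a x) < P.energy x

/-- The state after `t` sweeps that start from `x₀`. -/
def Data.iter (P : Data M N) (x₀ : State M N) (t : ℕ) : State M N := P.sweep^[t] x₀

/-- The sequence generated from `x₀` is finite, with last index `m`. -/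
def Data.TerminatesAt [NeZero N] (P : Data M N) (x₀ : State M N) (m : ℕ) : Prop :=
  P.Stops (P.iter x₀ m) ∧ ∀ t < m, ¬ P.Stops (P.iter x₀ t)

/-- The sequence generated from `x₀` is infinite. -/
def Data.RunsForever [NeZero N] (P : Data M N) (x₀ : State M N) : Prop :=
  ∀ t, ¬ P.Stops (P.iter x₀ t)

end PBLocal

end

/-! The energy is strictly convex and the constraints are affine, so everything turns on the edge
condition `IsEquilibrium`. Expanding the energy about a state `x` is exact (`energy_eq`): a linear
term, a quadratic term in the displacement, and Bregman divergences of `t log t`. If `x` is an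
equilibrium, the linear term vanishes on admissible differences by summation by parts
(`IsEquilibrium.slope_eq_zero`), and the other terms are positive off `x`. So an equilibrium is the
strict global minimizer, and there is at most one. The algorithm itself produces an equilibrium.
Each update lowers the energy by at least a constant times `ζ ^ 2` (`energy_update_le`). The energy
is bounded below, so all transfers tend to zero along the sweeps, and all intermediate states of a
sweep share the limits of the iterates. The logarithm-free form of the transfer equation passes to
the limit, even if concentrations were to vanish there, so every cluster point is an equilibrium
(`isEquilibrium_of_mapClusterPt`). Compactness of sublevel sets gives existence; uniqueness then
gives convergence of the whole sequence. -/

namespace PBLocal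

variable {M N : ℕ}

/-! ### Scalar inequalities for the entropy and the transfer equation. -/

section Scalar

/-- The Bregman divergence of `t ↦ t log t`. -/
noncomputable def relEntropy (a b : ℝ) : ℝ :=
  b * Real.log b - a * Real.log a - (Real.log a + 1) * (b - a)

/-- At `b = 0` the value is `a`; otherwise this is `log t < t - 1` at `t = a / b`, multiplied by
`b`. -/
theorem relEntropy_pos {a b : ℝ} (ha : 0 < a) (hb : 0 ≤ b) (hab : b ≠ a) :
    0 < relEntropy a b := by
  unfold relEntropy
  rcases hb.eq_or_lt with rfl | hb
  · ring_nf
    exact ha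
  · have h1 : a / b ≠ 1 := by
      rw [Ne, div_eq_one_iff_eq hb.ne']
      exact hab.symm
    have h2 := Real.log_lt_sub_one_of_pos (div_pos ha hb) h1
    rw [Real.log_div ha.ne' hb.ne'] at h2
    have h3 := mul_lt_mul_of_pos_left h2 hb
    have h4 : b * (a / b - 1) = a - b := by field_simp
    rw [h4] at h3
    linarith

theorem relEntropy_nonneg {a b : ℝ} (ha : 0 < a) (hb : 0 ≤ b) : 0 ≤ relEntropy a b := by
  by_cases hab : b = a
  · simp [relEntropy, hab]
  · exact (relEntropy_pos ha hb hab).le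

theorem neg_one_le_mul_log {c : ℝ} (hc : 0 ≤ c) : -1 ≤ c * Real.log c := by
  have := relEntropy_nonneg one_pos hc
  simp only [relEntropy, Real.log_one] at this
  linarith

/-- Without logarithms, both sides stay continuous where a concentration tends to zero. -/
theorem IsTransfer.exp_eq {h q e α β γ ζ : ℝ} (hz : IsTransfer h q e α β γ ζ) :
    β + ζ = (α - ζ) * Real.exp (h * q / e * (γ - h * q * ζ)) := by
  have h1 : 0 < α - ζ := by linarith [hz.1.2]
  have h2 : 0 < β + ζ := by linarith [hz.1.1]
  have h3 : h * q / e * (γ - h * q * ζ) = Real.log (β + ζ) - Real.log (α - ζ) := by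
    linarith [hz.2]
  rw [h3, Real.exp_sub, Real.exp_log h1, Real.exp_log h2]
  field_simp

/-- Needed for `N = 1`, where both ends of an edge are the same grid point. -/
theorem mul_log_sub_log_nonneg {c ζ : ℝ} (h1 : -c < ζ) (h2 : ζ < c) :
    0 ≤ ζ * (Real.log (c + ζ) - Real.log (c - ζ)) := by
  rcases le_total 0 ζ with h | h
  · exact mul_nonneg h (sub_nonneg.2 (Real.log_le_log (by linarith) (by linarith)))
  · exact mul_nonneg_of_nonpos_of_nonpos h
      (sub_nonpos.2 (Real.log_le_log (by linarith) (by linarith)))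

end Scalar

/-! ### Connectedness of the periodic grid and the enumeration of its edges. -/

section GridLemmas

/-- Positive steps suffice: by periodicity each coordinate difference is a natural multiple of the
unit step. -/
theorem Grid.induction [NeZero N] {S : Grid N → Prop} {p₀ : Grid N} (h0 : S p₀)
    (hs : ∀ p a, S p → S (p + step a)) (p : Grid N) : S p := by
  have hn : ∀ (n : ℕ) (a : Fin 3) (p : Grid N), S p → S (p + n • step a) := by
    intro n a
    induction n with
    | zero => intro p hp; simpa using hp
    | succ n ih =>
      intro p hp
      rw [succ_nsmul, ← add_assoc]
      exact hs _ _ (ih p hp)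
  have key := hn (p 2 - p₀ 2).val 2 _ (hn (p 1 - p₀ 1).val 1 _ (hn (p 0 - p₀ 0).val 0 _ h0))
  convert key using 1
  ext b
  fin_cases b <;> simp [step, -ZMod.natCast_val, ZMod.natCast_zmod_val]

theorem Grid.eq_of_step_invariant [NeZero N] {α : Type*} {f : Grid N → α}
    (hf : ∀ p a, f (p + step a) = f p) (p r : Grid N) : f p = f r :=
  Grid.induction (S := fun p => f p = f r) rfl (fun p a hp => (hf p a).trans hp) p

theorem Grid.sum_shift [NeZero N] (f : Grid N → ℝ) (a : Fin 3) :
    ∑ p, f (p - step a) = ∑ p, f p :=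
  Equiv.sum_comp (Equiv.subRight (step a)) f

theorem mem_gridList [NeZero N] (p : Grid N) : p ∈ gridList N := by
  have hcast : ∀ z : ZMod N, ∃ n < N, (n : ZMod N) = z := fun z =>
    ⟨z.val, ZMod.val_lt z, ZMod.natCast_zmod_val z⟩
  simp only [gridList, List.mem_flatMap, List.mem_map, List.pure_def, List.bind_eq_flatMap,
    List.mem_range, List.mem_singleton]
  obtain ⟨i, hi, hi'⟩ := hcast (p 0)
  obtain ⟨j, hj, hj'⟩ := hcast (p 1)
  obtain ⟨k, hk, hk'⟩ := hcast (p 2)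
  have hp : ![(i : ZMod N), (j : ZMod N), (k : ZMod N)] = p := by
    ext b
    fin_cases b <;> simp [hi', hj', hk']
  grind

theorem mem_updateList [NeZero N] (p : Grid N) (a : Fin 3) (s : Fin M) :
    (p, a, s) ∈ updateList M N := by
  simp only [updateList, List.mem_flatMap, List.mem_map]
  exact ⟨p, mem_gridList p, a, List.mem_finRange a, s, List.mem_finRange s, rfl⟩

end GridLemmas

namespace Data

variable (P : Data M N)

theorem h_pos [NeZero N] {P : Data M N} (hL : 0 < P.L) : 0 < P.h :=
  div_pos hL (Nat.cast_pos.2 (NeZero.pos N))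

theorem edgeEps_pos {P : Data M N} (heps : ∀ p, 0 < P.eps p) (a : Fin 3) (p : Grid N) :
    0 < P.edgeEps a p := by
  unfold edgeEps
  linarith [heps p, heps (p + step a)]

/-! ### Discrete divergence: summation by parts and range. -/

section Divergence

theorem div_sub (D D' : Fin 3 → Grid N → ℝ) (p : Grid N) :
    P.div (D - D') p = P.div D p - P.div D' p := by
  simp only [div, Pi.sub_apply, ← mul_sub, ← Finset.sum_sub_distrib]
  congr 1
  exact Finset.sum_congr rfl fun a _ => by ring

/-- The discrete divergence as a linear map. -/
noncomputable def divLinear : (Fin 3 → Grid N → ℝ) →ₗ[ℝ] (Grid N → ℝ) where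
  toFun := P.div
  map_add' D D' := by
    ext p
    simp only [div, Pi.add_apply, ← mul_add, ← Finset.sum_add_distrib]
    congr 1
    exact Finset.sum_congr rfl fun a _ => by ring
  map_smul' c D := by
    ext p
    simp only [div, Pi.smul_apply, smul_eq_mul, RingHom.id_apply, Finset.mul_sum]
    exact Finset.sum_congr rfl fun a _ => by ring

theorem div_single (a : Fin 3) (p r : Grid N) (t : ℝ) :
    P.div (Pi.single a (Pi.single p t)) r =
      (1 / P.h) * ((Pi.single p t : Grid N → ℝ) r - (Pi.single (p + step a) t : Grid N → ℝ) r) := by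
  unfold div
  congr 1
  rw [Finset.sum_eq_single a]
  · simp only [Pi.single_eq_same, Pi.single_apply, sub_eq_iff_eq_add]
  · intro b _ hb
    simp [Pi.single_eq_of_ne hb]
  · simp

/-- Summation by parts. -/
theorem sum_mul_div [NeZero N] {P : Data M N} (hh : 0 < P.h) (φ : Grid N → ℝ)
    (D : Fin 3 → Grid N → ℝ) :
    ∑ p, ∑ a, (φ (p + step a) - φ p) * D a p = -(P.h * ∑ p, φ p * P.div D p) := by
  have h1 : P.h * ∑ p, φ p * P.div D p = ∑ p, ∑ a, φ p * (D a p - D a (p - step a)) := by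
    rw [Finset.mul_sum]
    refine Finset.sum_congr rfl fun p _ => ?_
    rw [← Finset.mul_sum, div]
    field_simp
  rw [h1, Finset.sum_comm, Finset.sum_comm (f := fun p a => φ p * (D a p - D a (p - step a))),
    ← Finset.sum_neg_distrib]
  refine Finset.sum_congr rfl fun a _ => ?_
  have h2 : ∑ p, φ (p + step a) * D a p = ∑ p, φ p * D a (p - step a) := by
    rw [← Grid.sum_shift _ a]
    simp
  simp only [sub_mul, mul_sub, Finset.sum_sub_distrib, h2]
  ring

/-- A displacement on a single edge has as divergence a multiple of the difference of the point
masses at its ends. Along paths these add up to differences with the point mass at `0`, which span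
the functions of zero sum. -/
theorem exists_div_eq [NeZero N] {P : Data M N} (hh : 0 < P.h) {f : Grid N → ℝ}
    (hf : ∑ p, f p = 0) : ∃ D, P.div D = f := by
  classical
  suffices hmem : f ∈ LinearMap.range P.divLinear from hmem
  have hbasis : ∀ p : Grid N, (Pi.single p 1 - Pi.single 0 1 : Grid N → ℝ) ∈
      LinearMap.range P.divLinear := by
    refine Grid.induction (p₀ := 0) (by simp) fun p a hp => ?_
    have h1 : (Pi.single p 1 - Pi.single (p + step a) 1 : Grid N → ℝ) ∈
        LinearMap.range P.divLinear := by
      refine ⟨P.h • Pi.single a (Pi.single p 1), ?_⟩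
      rw [map_smul]
      ext r
      have := P.div_single a p r 1
      simp only [divLinear, LinearMap.coe_mk, AddHom.coe_mk, Pi.smul_apply, smul_eq_mul,
        Pi.sub_apply, this]
      field_simp
    have h2 := Submodule.sub_mem _ hp h1
    simpa using h2
  have hsum : f = ∑ p, f p • (Pi.single p 1 - Pi.single 0 1 : Grid N → ℝ) := by
    simp only [smul_sub, Finset.sum_sub_distrib, ← Finset.sum_smul, hf, zero_smul, sub_zero]
    ext r
    simp [Finset.sum_apply, Pi.single_apply]
  rw [hsum]
  exact Submodule.sum_mem _ fun p _ => Submodule.smul_mem _ _ (hbasis p)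

end Divergence

/-! ### Expansion of the energy, equilibria as strict minimizers, compact sublevel sets. -/

section Energy

variable [NeZero N]

/-- The derivative of the energy at `x` in the direction `y - x`, divided by `h³`. -/
noncomputable def slope (x y : State M N) : ℝ :=
  (∑ p, ∑ a, x.2 a p / P.edgeEps a p * (y.2 a p - x.2 a p)) +
    ∑ s, ∑ p, (Real.log (x.1 s p) + 1) * (y.1 s p - x.1 s p)

/-- A purely algebraic identity, used with two base points: an equilibrium, and the result of a
local update. -/
theorem energy_eq (x y : State M N) :
    P.energy y = P.energy x + P.h ^ 3 * (P.slope x y +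
      (∑ p, ∑ a, (y.2 a p - x.2 a p) ^ 2 / (2 * P.edgeEps a p)) +
      ∑ s, ∑ p, relEntropy (x.1 s p) (y.1 s p)) := by
  have h1 : ∀ z : State M N, P.energy z = P.h ^ 3 *
      ((∑ p, ∑ a, z.2 a p ^ 2 / (2 * P.edgeEps a p)) +
        ∑ s, ∑ p, z.1 s p * Real.log (z.1 s p)) := by
    intro z
    have : ∑ p, ∑ a, z.2 a p ^ 2 / (2 * P.edgeEps a p) =
        (1 / 2) * ∑ p, ∑ a, z.2 a p ^ 2 / P.edgeEps a p := by
      simp only [Finset.mul_sum]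
      refine Finset.sum_congr rfl fun p _ => Finset.sum_congr rfl fun a _ => ?_
      rw [mul_comm 2, ← div_div]
      ring
    rw [this, energy]
    ring
  have h2 : ∑ p, ∑ a, y.2 a p ^ 2 / (2 * P.edgeEps a p) =
      (∑ p, ∑ a, x.2 a p ^ 2 / (2 * P.edgeEps a p)) +
      (∑ p, ∑ a, x.2 a p / P.edgeEps a p * (y.2 a p - x.2 a p)) +
      ∑ p, ∑ a, (y.2 a p - x.2 a p) ^ 2 / (2 * P.edgeEps a p) := by
    simp only [← Finset.sum_add_distrib]
    refine Finset.sum_congr rfl fun p _ => Finset.sum_congr rfl fun a _ => ?_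
    simp only [← div_div]
    ring
  have h3 : ∑ s, ∑ p, y.1 s p * Real.log (y.1 s p) =
      (∑ s, ∑ p, x.1 s p * Real.log (x.1 s p)) +
      (∑ s, ∑ p, (Real.log (x.1 s p) + 1) * (y.1 s p - x.1 s p)) +
      ∑ s, ∑ p, relEntropy (x.1 s p) (y.1 s p) := by
    simp only [← Finset.sum_add_distrib]
    refine Finset.sum_congr rfl fun p _ => Finset.sum_congr rfl fun a _ => ?_
    unfold relEntropy
    ring
  rw [h1 x, h1 y, h2, h3, slope]
  ring

/-- The optimality conditions: every edge is in equilibrium for every species. -/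
def IsEquilibrium (x : State M N) : Prop :=
  ∀ s p a, x.1 s (p + step a) = x.1 s p * Real.exp (P.h * P.q s / P.edgeEps a p * x.2 a p)

variable {P}

theorem sum_conc (hh : 0 < P.h) {x : State M N} (hx : x ∈ P.X) (s : Fin M) :
    ∑ p, x.1 s p = P.mass s / P.h ^ 3 := by
  rw [eq_div_iff (pow_pos hh 3).ne', mul_comm, hx.2.1 s]

/-- Positive mass forces a positive value somewhere, and the exponential edge relation carries
positivity across the connected grid. -/
theorem IsEquilibrium.pos (hh : 0 < P.h) (hmass : ∀ s, 0 < P.mass s) {x : State M N}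
    (hX : x ∈ P.X) (hx : P.IsEquilibrium x) (s : Fin M) (p : Grid N) : 0 < x.1 s p := by
  have hsum : 0 < ∑ p, x.1 s p := by
    rw [sum_conc hh hX]
    exact div_pos (hmass s) (pow_pos hh 3)
  obtain ⟨p₀, -, hp₀⟩ := Finset.exists_lt_of_sum_lt
    (show ∑ _p : Grid N, (0 : ℝ) < ∑ p, x.1 s p by simpa using hsum)
  refine Grid.induction (S := fun p => 0 < x.1 s p) hp₀ (fun p a hp => ?_) p
  rw [hx s p a]
  exact mul_pos hp (Real.exp_pos _)

/-- At equilibrium `D / ε` is the discrete gradient of one potential `φ`, and `log c_s` is `q_s φ`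
plus a constant. By Gauss' law and summation by parts, the displacement and entropy parts of the
slope cancel. -/
theorem IsEquilibrium.slope_eq_zero [NeZero M] (hh : 0 < P.h) (hq : ∀ s, P.q s ≠ 0)
    {x y : State M N} (hx : P.IsEquilibrium x) (hpos : ∀ s p, 0 < x.1 s p)
    (hX : x ∈ P.X) (hY : y ∈ P.X) : P.slope x y = 0 := by
  have hlog : ∀ s p a, Real.log (x.1 s (p + step a)) - Real.log (x.1 s p) =
      P.h * P.q s * (x.2 a p / P.edgeEps a p) := by
    intro s p a
    rw [hx s p a, Real.log_mul (hpos s p).ne' (Real.exp_pos _).ne', Real.log_exp]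
    ring
  -- Any species would define the same potential up to an additive constant.
  set φ : Grid N → ℝ := fun p => Real.log (x.1 0 p) / P.q 0 with hφ
  have hφstep : ∀ p a, φ (p + step a) - φ p = P.h * (x.2 a p / P.edgeEps a p) := by
    intro p a
    have := hq 0
    simp only [hφ, ← _root_.sub_div, hlog]
    field_simp
  have hconst : ∀ s p, Real.log (x.1 s p) - P.q s * φ p =
      Real.log (x.1 s 0) - P.q s * φ 0 := by
    intro s p
    refine Grid.eq_of_step_invariant (f := fun p => Real.log (x.1 s p) - P.q s * φ p)
      (fun p a => ?_) p 0
    linear_combination hlog s p a - P.q s * hφstep p a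
  have hdiv : ∀ p, P.div (y.2 - x.2) p = ∑ s, P.q s * (y.1 s p - x.1 s p) := by
    intro p
    rw [div_sub, hY.2.2 p, hX.2.2 p]
    simp only [mul_sub, Finset.sum_sub_distrib]
    ring
  have hD : ∑ p, ∑ a, x.2 a p / P.edgeEps a p * (y.2 a p - x.2 a p) =
      -∑ p, φ p * P.div (y.2 - x.2) p := by
    have h1 := sum_mul_div hh φ (y.2 - x.2)
    have h2 : ∑ p, ∑ a, (φ (p + step a) - φ p) * (y.2 - x.2) a p =
        P.h * ∑ p, ∑ a, x.2 a p / P.edgeEps a p * (y.2 a p - x.2 a p) := by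
      simp only [Finset.mul_sum, hφstep, Pi.sub_apply, mul_assoc]
    rw [h2, ← mul_neg] at h1
    exact mul_left_cancel₀ hh.ne' h1
  have hc : ∑ s, ∑ p, (Real.log (x.1 s p) + 1) * (y.1 s p - x.1 s p) =
      ∑ p, φ p * P.div (y.2 - x.2) p := by
    have h1 : ∀ s, ∑ p, (Real.log (x.1 s p) + 1) * (y.1 s p - x.1 s p) =
        ∑ p, φ p * (P.q s * (y.1 s p - x.1 s p)) := by
      intro s
      -- The constant part is multiplied by the change of total mass, which is zero.
      have h2 : ∑ p, (Real.log (x.1 s 0) - P.q s * φ 0 + 1) * (y.1 s p - x.1 s p) = 0 := by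
        rw [← Finset.mul_sum, Finset.sum_sub_distrib, sum_conc hh hX, sum_conc hh hY, sub_self,
          mul_zero]
      rw [← sub_eq_zero, ← Finset.sum_sub_distrib, ← h2]
      refine Finset.sum_congr rfl fun p _ => ?_
      rw [← hconst s p]
      ring
    simp only [h1, hdiv, Finset.mul_sum]
    exact Finset.sum_comm
  rw [slope, hD, hc, neg_add_cancel]

theorem IsEquilibrium.energy_lt [NeZero M] (hh : 0 < P.h) (hq : ∀ s, P.q s ≠ 0)
    (hmass : ∀ s, 0 < P.mass s) (heps : ∀ p, 0 < P.eps p) {x y : State M N}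
    (hx : P.IsEquilibrium x) (hX : x ∈ P.X) (hY : y ∈ P.X) (hne : y ≠ x) :
    P.energy x < P.energy y := by
  have hpos := hx.pos hh hmass hX
  rw [P.energy_eq x y, hx.slope_eq_zero hh hq hpos hX hY, zero_add, lt_add_iff_pos_right]
  refine mul_pos (pow_pos hh 3) ?_
  have hquad : ∀ p a, 0 ≤ (y.2 a p - x.2 a p) ^ 2 / (2 * P.edgeEps a p) := fun p a =>
    div_nonneg (sq_nonneg _) (mul_pos two_pos (edgeEps_pos heps a p)).le
  have hent : ∀ s p, 0 ≤ relEntropy (x.1 s p) (y.1 s p) := fun s p =>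
    relEntropy_nonneg (hpos s p) (hY.1 s p)
  have hquad' := Finset.sum_nonneg fun p (_ : p ∈ Finset.univ) =>
    Finset.sum_nonneg fun a (_ : a ∈ Finset.univ) => hquad p a
  have hent' := Finset.sum_nonneg fun s (_ : s ∈ Finset.univ) =>
    Finset.sum_nonneg fun p (_ : p ∈ Finset.univ) => hent s p
  refine lt_of_le_of_ne (add_nonneg hquad' hent') fun h0 => hne ?_
  obtain ⟨h1, h2⟩ := (add_eq_zero_iff_of_nonneg hquad' hent').1 h0.symm
  rw [Finset.sum_eq_zero_iff_of_nonneg fun p _ => Finset.sum_nonneg fun a _ => hquad p a] at h1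
  rw [Finset.sum_eq_zero_iff_of_nonneg fun s _ => Finset.sum_nonneg fun p _ => hent s p] at h2
  ext s p
  · have h3 := (Finset.sum_eq_zero_iff_of_nonneg fun p _ => hent s p).1 (h2 s (Finset.mem_univ s))
      p (Finset.mem_univ p)
    by_contra hsp
    exact (relEntropy_pos (hpos s p) (hY.1 s p) hsp).ne' h3
  · have h3 := (Finset.sum_eq_zero_iff_of_nonneg fun a _ => hquad p a).1
      (h1 p (Finset.mem_univ p)) s (Finset.mem_univ s)
    rw [div_eq_zero_iff, or_iff_left (mul_pos two_pos (edgeEps_pos heps s p)).ne',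
      sq_eq_zero_iff, sub_eq_zero] at h3
    exact h3

theorem continuous_energy : Continuous P.energy := by
  unfold energy
  refine Continuous.add (by fun_prop) ?_
  refine continuous_const.mul (continuous_finsetSum _ fun s _ => continuous_finsetSum _ fun p _ => ?_)
  exact Real.continuous_mul_log.comp (by fun_prop)

theorem isClosed_X : IsClosed P.X := by
  simp only [X, Set.ofPred_and, Set.ofPred_forall, div]
  refine IsClosed.inter ?_ (IsClosed.inter ?_ ?_)
  · exact isClosed_iInter fun s => isClosed_iInter fun p => isClosed_le (by fun_prop) (by fun_prop)
  · exact isClosed_iInter fun s => isClosed_eq (by fun_prop) (by fun_prop)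
  · exact isClosed_iInter fun p => isClosed_eq (by fun_prop) (by fun_prop)

theorem neg_card_le_entropy {x : State M N} (hx : x ∈ P.X) :
    -(∑ _s : Fin M, ∑ _p : Grid N, (1 : ℝ)) ≤ ∑ s, ∑ p, x.1 s p * Real.log (x.1 s p) := by
  simp only [← Finset.sum_neg_distrib]
  exact Finset.sum_le_sum fun s _ => Finset.sum_le_sum fun p _ => neg_one_le_mul_log (hx.1 s p)

theorem energy_bddBelow (hh : 0 < P.h) (heps : ∀ p, 0 < P.eps p) :
    ∃ b, ∀ x ∈ P.X, b ≤ P.energy x := by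
  refine ⟨P.h ^ 3 * -(∑ _s : Fin M, ∑ _p : Grid N, (1 : ℝ)), fun x hx => ?_⟩
  have h1 := mul_le_mul_of_nonneg_left (neg_card_le_entropy hx) (pow_pos hh 3).le
  have h2 : 0 ≤ P.h ^ 3 * ∑ p, ∑ a, x.2 a p ^ 2 / P.edgeEps a p :=
    mul_nonneg (pow_pos hh 3).le (Finset.sum_nonneg fun p _ => Finset.sum_nonneg fun a _ =>
      div_nonneg (sq_nonneg _) (edgeEps_pos heps a p).le)
  unfold energy
  linarith

theorem isCompact_sublevel (hh : 0 < P.h) (heps : ∀ p, 0 < P.eps p) (E : ℝ) :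
    IsCompact {x | x ∈ P.X ∧ P.energy x ≤ E} := by
  -- The entropy sum is at least `-C`, so `R` bounds the sum of all `D ^ 2 / ε`. Conservation of
  -- mass bounds the concentrations.
  set C : ℝ := ∑ _s : Fin M, ∑ _p : Grid N, (1 : ℝ) with hC
  set R : ℝ := 2 * (E / P.h ^ 3 + C) with hR
  set B : State M N := (fun s _ => P.mass s / P.h ^ 3, fun a p => √(P.edgeEps a p * R)) with hB
  refine IsCompact.of_isClosed_subset (isCompact_Icc (a := ((0, -B.2) : State M N)) (b := B))
    (isClosed_X.inter (isClosed_le continuous_energy continuous_const)) ?_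
  rintro x ⟨hx, hE⟩
  have hD : ∀ a p, |x.2 a p| ≤ B.2 a p := by
    intro a p
    have he := edgeEps_pos heps a p
    have h1 : x.2 a p ^ 2 / P.edgeEps a p ≤ ∑ p, ∑ a, x.2 a p ^ 2 / P.edgeEps a p := by
      have hnn : ∀ p a, 0 ≤ x.2 a p ^ 2 / P.edgeEps a p := fun p a =>
        div_nonneg (sq_nonneg _) (edgeEps_pos heps a p).le
      refine (Finset.single_le_sum (f := fun a => x.2 a p ^ 2 / P.edgeEps a p)
        (fun a _ => hnn p a) (Finset.mem_univ a)).trans ?_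
      exact Finset.single_le_sum (f := fun p => ∑ a, x.2 a p ^ 2 / P.edgeEps a p)
        (fun p _ => Finset.sum_nonneg fun a _ => hnn p a) (Finset.mem_univ p)
    have h2 : ∑ p, ∑ a, x.2 a p ^ 2 / P.edgeEps a p ≤ R := by
      have h3 := neg_card_le_entropy hx
      have h4 : (1 / 2) * (∑ p, ∑ a, x.2 a p ^ 2 / P.edgeEps a p) +
          ∑ s, ∑ p, x.1 s p * Real.log (x.1 s p) ≤ E / P.h ^ 3 := by
        rw [le_div_iff₀ (pow_pos hh 3)]
        unfold energy at hE
        linarith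
      linarith
    refine Real.abs_le_sqrt ?_
    have h5 := (div_le_iff₀ he).1 (h1.trans h2)
    linarith
  refine ⟨⟨fun s p => hx.1 s p, fun a p => (abs_le.1 (hD a p)).1⟩,
    ⟨fun s p => ?_, fun a p => (abs_le.1 (hD a p)).2⟩⟩
  rw [hB]
  simp only
  rw [← sum_conc hh hx s]
  exact Finset.single_le_sum (f := fun p => x.1 s p) (fun p _ => hx.1 s p) (Finset.mem_univ p)

end Energy

/-! ### One local update: admissibility, energy decrease, passage to the limit. -/

section Update

/-- The direction of the local update of the species `s` on the edge from `p` to `p + step a`. -/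
noncomputable def direction (s : Fin M) (p : Grid N) (a : Fin 3) : State M N :=
  (Pi.single s (Pi.single (p + step a) 1 - Pi.single p 1),
    -Pi.single a (Pi.single p (P.h * P.q s)))

theorem update_eq (s : Fin M) (p : Grid N) (a : Fin 3) (x : State M N) :
    P.update s p a x = x + P.zeta s p a x • P.direction s p a := by
  ext t r
  · simp only [update, direction, Prod.fst_add, Prod.smul_fst, Pi.add_apply, Pi.smul_apply,
      Pi.single_apply]
    split_ifs <;> simp [Pi.single_apply, mul_sub]
  · simp only [update, direction, Prod.snd_add, Prod.smul_snd, Pi.add_apply, Pi.smul_apply,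
      Pi.sub_apply, Pi.neg_apply, Pi.single_apply]
    split_ifs <;> simp [Pi.single_apply]
    ring_nf

theorem update_conc_of_ne {s t : Fin M} (hts : t ≠ s) (p : Grid N) (a : Fin 3) (x : State M N) :
    (P.update s p a x).1 t = x.1 t := by
  simp [update, Pi.single_eq_of_ne hts]

theorem update_conc (s : Fin M) (p : Grid N) (a : Fin 3) (x : State M N) (r : Grid N) :
    (P.update s p a x).1 s r = x.1 s r + ((if r = p + step a then P.zeta s p a x else 0) -
      (if r = p then P.zeta s p a x else 0)) := by
  simp [update, Pi.single_apply]

theorem update_disp (s : Fin M) (p : Grid N) (a : Fin 3) (x : State M N) :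
    (P.update s p a x).2 a p = x.2 a p - P.h * P.q s * P.zeta s p a x := by
  simp [update]

variable [NeZero N]

/-- The admissible states with positive concentrations. -/
def XPos : Set (State M N) :=
  {x | x ∈ P.X ∧ ∀ s p, 0 < x.1 s p}

variable {P}

theorem isTransfer_zeta (heps : ∀ p, 0 < P.eps p) {x : State M N} (hx : x ∈ P.XPos)
    (s : Fin M) (p : Grid N) (a : Fin 3) :
    IsTransfer P.h (P.q s) (P.edgeEps a p) (x.1 s p) (x.1 s (p + step a)) (x.2 a p)
      (P.zeta s p a x) :=
  transfer_spec _ _ _ (edgeEps_pos heps a p) (hx.2 s p) (hx.2 s _)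

/-- The interval for `ζ` keeps concentrations positive, and the displacement change `h q_s ζ`
compensates the moved charge in Gauss' law at both ends. -/
theorem update_mem_XPos (hh : 0 < P.h) (heps : ∀ p, 0 < P.eps p) {x : State M N}
    (hx : x ∈ P.XPos) (s : Fin M) (p : Grid N) (a : Fin 3) : P.update s p a x ∈ P.XPos := by
  have hz := (isTransfer_zeta heps hx s p a).1
  have hpos : ∀ t r, 0 < (P.update s p a x).1 t r := by
    intro t r
    by_cases hts : t = s
    · subst hts
      rw [update_conc]
      have := hx.2 t r
      obtain ⟨hz1, hz2⟩ := hz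
      split_ifs with h1 h2 h2
      · linarith
      · rw [← h1] at hz1
        linarith
      · rw [h2]
        linarith
      · linarith
    · rw [update_conc_of_ne P hts]
      exact hx.2 t r
  refine ⟨⟨fun t r => (hpos t r).le, fun t => ?_, fun r => ?_⟩, hpos⟩
  · rw [← hx.1.2.1 t]
    congr 1
    by_cases hts : t = s
    · subst hts
      simp [update_conc, Finset.sum_add_distrib]
    · rw [update_conc_of_ne P hts]
  · have h1 : ∑ t, P.q t * (P.update s p a x).1 t r = ∑ t, P.q t * x.1 t r +
        P.q s * ((if r = p + step a then P.zeta s p a x else 0) -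
          (if r = p then P.zeta s p a x else 0)) := by
      rw [← sub_eq_iff_eq_add', ← Finset.sum_sub_distrib, Finset.sum_eq_single s]
      · rw [update_conc]
        ring
      · intro t _ hts
        rw [update_conc_of_ne P hts, sub_self]
      · simp
    have h2 : P.div (P.update s p a x).2 r = P.div x.2 r -
        P.div (Pi.single a (Pi.single p (P.h * P.q s * P.zeta s p a x))) r := P.div_sub _ _ r
    rw [h1, h2, hx.1.2.2 r, div_single]
    simp only [Pi.single_apply]
    split_ifs <;> field_simp <;> ring_nf

/-- A local update decreases the energy at least quadratically in the amount moved. -/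
theorem energy_update_le (hh : 0 < P.h) (heps : ∀ p, 0 < P.eps p) {x : State M N}
    (hx : x ∈ P.XPos) (s : Fin M) (p : Grid N) (a : Fin 3) :
    P.energy (P.update s p a x) + P.h ^ 3 * ((P.h * P.q s) ^ 2 / (2 * P.edgeEps a p)) *
      P.zeta s p a x ^ 2 ≤ P.energy x := by
  have hz := isTransfer_zeta heps hx s p a
  have hy := update_mem_XPos hh heps hx s p a
  have hup := P.update_eq s p a x
  have hc1 := P.update_conc s p a x
  have hd1 := P.update_disp s p a x
  set ζ := P.zeta s p a x
  set y := P.update s p a x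
  have he := edgeEps_pos heps a p
  have hyx : ∀ b r, x.2 b r - y.2 b r = if b = a ∧ r = p then P.h * P.q s * ζ else 0 := by
    intro b r
    rw [hup]
    simp only [direction, Prod.snd_add, Prod.smul_snd, Pi.add_apply, Pi.smul_apply, Pi.neg_apply,
      Pi.single_apply, smul_eq_mul]
    split_ifs with h1 h2 h2 <;> simp_all
    ring
  have hquad : ∑ r, ∑ b, (x.2 b r - y.2 b r) ^ 2 / (2 * P.edgeEps b r) =
      (P.h * P.q s) ^ 2 / (2 * P.edgeEps a p) * ζ ^ 2 := by
    rw [Finset.sum_eq_single p, Finset.sum_eq_single a]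
    · rw [hyx, if_pos ⟨rfl, rfl⟩]
      ring
    · intro b _ hb
      simp [hyx, hb]
    · simp
    · intro r _ hr
      simp [hyx, hr]
    · simp
  have hslopeD : ∑ r, ∑ b, y.2 b r / P.edgeEps b r * (x.2 b r - y.2 b r) =
      ζ * (P.h * P.q s / P.edgeEps a p * y.2 a p) := by
    rw [Finset.sum_eq_single p, Finset.sum_eq_single a]
    · rw [hyx, if_pos ⟨rfl, rfl⟩]
      ring
    · intro b _ hb
      simp [hyx, hb]
    · simp
    · intro r _ hr
      simp [hyx, hr]
    · simp
  have hslopeC : ∑ t, ∑ r, (Real.log (y.1 t r) + 1) * (x.1 t r - y.1 t r) =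
      -(ζ * (Real.log (y.1 s (p + step a)) - Real.log (y.1 s p))) := by
    rw [Finset.sum_eq_single s]
    · have h1 : ∀ r, (Real.log (y.1 s r) + 1) * (x.1 s r - y.1 s r) =
          (if r = p then (Real.log (y.1 s r) + 1) * ζ else 0) -
          (if r = p + step a then (Real.log (y.1 s r) + 1) * ζ else 0) := by
        intro r
        have : x.1 s r - y.1 s r = (if r = p then ζ else 0) - if r = p + step a then ζ else 0 := by
          rw [hc1 r]
          ring
        rw [this]
        split_ifs <;> ring
      simp only [h1, Finset.sum_sub_distrib, Finset.sum_ite_eq', Finset.mem_univ, if_true]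
      ring
    · intro t _ hts
      have : y.1 t = x.1 t := P.update_conc_of_ne hts p a x
      simp [this]
    · simp
  -- This says that the slope at `y` towards `x` is nonnegative. It is zero by the transfer equation
  -- unless the edge is a loop.
  have hlog : ζ * (Real.log (y.1 s (p + step a)) - Real.log (y.1 s p)) ≤
      ζ * (P.h * P.q s / P.edgeEps a p * y.2 a p) := by
    have h1 : P.h * P.q s / P.edgeEps a p * y.2 a p =
        Real.log (x.1 s (p + step a) + ζ) - Real.log (x.1 s p - ζ) := by
      rw [hd1]
      linarith [hz.2]
    rw [h1]
    -- On a loop (`N = 1`) the concentrations do not change, so their logarithms cancel and only a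
    -- sign remains to be checked.
    by_cases hloop : p + step a = p
    · rw [hloop] at hz ⊢
      rw [sub_self, mul_zero]
      exact mul_log_sub_log_nonneg hz.1.1 hz.1.2
    · rw [hc1, hc1, if_pos rfl, if_neg hloop, if_neg (Ne.symm hloop), if_pos rfl, sub_zero,
        zero_sub, ← sub_eq_add_neg]
  have hent : 0 ≤ ∑ t, ∑ r, relEntropy (y.1 t r) (x.1 t r) :=
    Finset.sum_nonneg fun t _ => Finset.sum_nonneg fun r _ =>
      relEntropy_nonneg (hy.2 t r) (hx.2 t r).le
  -- The expansion is about the updated state: the quadratic term is the claimed gain, and slope and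
  -- entropy terms are nonnegative.
  rw [P.energy_eq y x, slope, hquad, hslopeD, hslopeC, mul_assoc (P.h ^ 3)]
  exact add_le_add le_rfl (mul_le_mul_of_nonneg_left (by linarith) (pow_pos hh 3).le)

theorem energy_update_le_self (hh : 0 < P.h) (heps : ∀ p, 0 < P.eps p) {x : State M N}
    (hx : x ∈ P.XPos) (s : Fin M) (p : Grid N) (a : Fin 3) :
    P.energy (P.update s p a x) ≤ P.energy x := by
  refine le_trans (le_add_of_nonneg_right ?_) (energy_update_le hh heps hx s p a)
  have := edgeEps_pos heps a p
  positivity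

/-- In the limit of vanishing transfers the edge is in equilibrium. -/
theorem edge_equilibrium_of_tendsto (heps : ∀ p, 0 < P.eps p) {ι : Type*} {l : Filter ι} [l.NeBot]
    {u : ι → State M N} {x : State M N} (hu : ∀ i, u i ∈ P.XPos) (hlim : Tendsto u l (𝓝 x))
    {s : Fin M} {p : Grid N} {a : Fin 3}
    (hz : Tendsto (fun i => P.zeta s p a (u i)) l (𝓝 0)) :
    x.1 s (p + step a) = x.1 s p * Real.exp (P.h * P.q s / P.edgeEps a p * x.2 a p) := by
  have h1 : ∀ r, Tendsto (fun i => (u i).1 s r) l (𝓝 (x.1 s r)) := fun r =>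
    ((show Continuous fun y : State M N => y.1 s r by fun_prop).tendsto x).comp hlim
  have h2 : Tendsto (fun i => (u i).2 a p) l (𝓝 (x.2 a p)) :=
    ((show Continuous fun y : State M N => y.2 a p by fun_prop).tendsto x).comp hlim
  have h3 := (h1 (p + step a)).add hz
  have h4 := ((h1 p).sub hz).mul ((Real.continuous_exp.tendsto _).comp
    ((h2.sub (hz.const_mul (P.h * P.q s))).const_mul (P.h * P.q s / P.edgeEps a p)))
  have h5 := tendsto_nhds_unique
    (h3.congr fun i => (isTransfer_zeta heps (hu i) s p a).exp_eq) h4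
  simpa using h5

end Update

/-! ### Sweeps, vanishing transfers, and cluster points. -/

section Sweep

/-- The state after the updates in the list `l`. -/
noncomputable def updates (l : List (Grid N × Fin 3 × Fin M)) (x : State M N) : State M N :=
  l.foldl (fun y r => P.update r.2.2 r.1 r.2.1 y) x

theorem updates_append (l l' : List (Grid N × Fin 3 × Fin M)) (x : State M N) :
    P.updates (l ++ l') x = P.updates l' (P.updates l x) :=
  List.foldl_append

variable [NeZero N] {P}

theorem updates_mem_XPos (hh : 0 < P.h) (heps : ∀ p, 0 < P.eps p)
    (l : List (Grid N × Fin 3 × Fin M)) {x : State M N} (hx : x ∈ P.XPos) :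
    P.updates l x ∈ P.XPos := by
  induction l generalizing x with
  | nil => exact hx
  | cons r l ih => exact ih (update_mem_XPos hh heps hx _ _ _)

theorem energy_updates_le (hh : 0 < P.h) (heps : ∀ p, 0 < P.eps p)
    (l : List (Grid N × Fin 3 × Fin M)) {x : State M N} (hx : x ∈ P.XPos) :
    P.energy (P.updates l x) ≤ P.energy x := by
  induction l generalizing x with
  | nil => exact le_rfl
  | cons r l ih =>
    exact (ih (update_mem_XPos hh heps hx _ _ _)).trans (energy_update_le_self hh heps hx _ _ _)

theorem energy_sweep_le (hh : 0 < P.h) (heps : ∀ p, 0 < P.eps p)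
    {l l' : List (Grid N × Fin 3 × Fin M)} {p : Grid N} {a : Fin 3} {s : Fin M}
    (hl : updateList M N = l ++ (p, a, s) :: l') {x : State M N} (hx : x ∈ P.XPos) :
    P.energy (P.sweep x) + P.h ^ 3 * ((P.h * P.q s) ^ 2 / (2 * P.edgeEps a p)) *
      P.zeta s p a (P.updates l x) ^ 2 ≤ P.energy x := by
  have h0 : P.sweep x = P.updates l' (P.update s p a (P.updates l x)) := by
    change P.updates (updateList M N) x = _
    rw [hl, updates_append]
    rfl
  have hx' := updates_mem_XPos hh heps l hx
  have h1 := energy_updates_le hh heps l hx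
  have h2 := energy_update_le hh heps hx' s p a
  have h3 := energy_updates_le hh heps l' (update_mem_XPos hh heps hx' s p a)
  rw [h0]
  linarith

omit [NeZero N] in
theorem iter_succ (x₀ : State M N) (t : ℕ) : P.iter x₀ (t + 1) = P.sweep (P.iter x₀ t) :=
  Function.iterate_succ_apply' _ _ _

theorem iter_mem_XPos (hh : 0 < P.h) (heps : ∀ p, 0 < P.eps p) {x₀ : State M N}
    (hx : x₀ ∈ P.XPos) (t : ℕ) : P.iter x₀ t ∈ P.XPos := by
  induction t with
  | zero => exact hx
  | succ t ih =>
    rw [iter_succ]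
    exact updates_mem_XPos hh heps (updateList M N) ih

theorem antitone_energy_iter (hh : 0 < P.h) (heps : ∀ p, 0 < P.eps p) {x₀ : State M N}
    (hx : x₀ ∈ P.XPos) : Antitone fun t => P.energy (P.iter x₀ t) := by
  refine antitone_nat_of_succ_le fun t => ?_
  rw [iter_succ]
  exact energy_updates_le hh heps (updateList M N) (iter_mem_XPos hh heps hx t)

/-- The energies converge, so their consecutive differences, which dominate `k * ζ ^ 2`, tend to
zero; `k > 0` because the charge is nonzero. -/
theorem tendsto_zeta_iter (hh : 0 < P.h) (heps : ∀ p, 0 < P.eps p) (hq : ∀ s, P.q s ≠ 0)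
    {l l' : List (Grid N × Fin 3 × Fin M)} {p : Grid N} {a : Fin 3} {s : Fin M}
    (hl : updateList M N = l ++ (p, a, s) :: l') {x₀ : State M N} (hx : x₀ ∈ P.XPos) :
    Tendsto (fun t => P.zeta s p a (P.updates l (P.iter x₀ t))) atTop (𝓝 0) := by
  obtain ⟨b, hb⟩ := energy_bddBelow hh heps
  have hE := tendsto_atTop_ciInf (antitone_energy_iter hh heps hx)
    ⟨b, by rintro _ ⟨t, rfl⟩; exact hb _ (iter_mem_XPos hh heps hx t).1⟩
  have hdiff := hE.sub (hE.comp (tendsto_add_atTop_nat 1))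
  rw [sub_self] at hdiff
  set k : ℝ := P.h ^ 3 * ((P.h * P.q s) ^ 2 / (2 * P.edgeEps a p)) with hk
  have hkpos : 0 < k := by
    have := edgeEps_pos heps a p
    have := hq s
    positivity
  have hsq : Tendsto (fun t => P.zeta s p a (P.updates l (P.iter x₀ t)) ^ 2) atTop (𝓝 0) := by
    refine squeeze_zero (fun t => sq_nonneg _) (fun t => ?_) (by simpa using hdiff.div_const k)
    rw [le_div_iff₀ hkpos]
    have := energy_sweep_le hh heps hl (iter_mem_XPos hh heps hx t)
    simp only [iter_succ]
    linarith
  have habs := hsq.sqrt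
  simp only [Real.sqrt_sq_eq_abs, Real.sqrt_zero] at habs
  exact (tendsto_zero_iff_abs_tendsto_zero _).2 habs

/-- An edge is treated in the middle of a sweep, so its limit equation needs the intermediate
states. Each update shifts the state by `ζ` times a fixed direction, with `ζ` tending to zero. -/
theorem tendsto_updates_iter (hh : 0 < P.h) (heps : ∀ p, 0 < P.eps p) (hq : ∀ s, P.q s ≠ 0)
    {x₀ x : State M N} (hx : x₀ ∈ P.XPos) {F : Filter ℕ} (hF : F ≤ atTop)
    (hlim : Tendsto (P.iter x₀) F (𝓝 x)) (l : List (Grid N × Fin 3 × Fin M)) :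
    ∀ l', updateList M N = l ++ l' → Tendsto (fun t => P.updates l (P.iter x₀ t)) F (𝓝 x) := by
  induction l using List.reverseRecOn with
  | nil => exact fun _ _ => hlim
  | append_singleton l r ih =>
    intro l' hl
    obtain ⟨p, a, s⟩ := r
    rw [List.append_assoc, List.singleton_append] at hl
    have h1 := (ih _ hl).add
      (((tendsto_zeta_iter hh heps hq hl hx).mono_left hF).smul_const (P.direction s p a))
    rw [zero_smul, add_zero] at h1
    refine h1.congr fun t => ?_
    rw [updates_append, ← update_eq]
    rfl

theorem isEquilibrium_of_mapClusterPt (hh : 0 < P.h) (heps : ∀ p, 0 < P.eps p)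
    (hq : ∀ s, P.q s ≠ 0) {x₀ x : State M N} (hx : x₀ ∈ P.XPos)
    (hcl : MapClusterPt x atTop (P.iter x₀)) : P.IsEquilibrium x := by
  obtain ⟨U, hU, hlim⟩ := mapClusterPt_iff_ultrafilter.1 hcl
  intro s p a
  obtain ⟨l, l', hl⟩ := List.append_of_mem (mem_updateList (M := M) p a s)
  exact edge_equilibrium_of_tendsto heps
    (fun t => updates_mem_XPos hh heps l (iter_mem_XPos hh heps hx t))
    (tendsto_updates_iter hh heps hq hx hU hlim l _ hl)
    ((tendsto_zeta_iter hh heps hq hl hx).mono_left hU)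

theorem isEquilibrium_of_stops (hh : 0 < P.h) (heps : ∀ p, 0 < P.eps p)
    (hq : ∀ s, P.q s ≠ 0) {x : State M N} (hx : x ∈ P.XPos) (hhalt : P.Stops x) :
    P.IsEquilibrium x := by
  intro s p a
  have h1 := energy_update_le hh heps hx s p a
  have h2 := not_lt.1 (hhalt s p a)
  have hk : 0 < P.h ^ 3 * ((P.h * P.q s) ^ 2 / (2 * P.edgeEps a p)) := by
    have := edgeEps_pos heps a p
    have := hq s
    positivity
  have hz : P.zeta s p a x = 0 := by
    by_contra hne
    have := mul_pos hk (pow_pos (abs_pos.2 hne) 2)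
    rw [sq_abs] at this
    linarith
  have h3 := (isTransfer_zeta heps hx s p a).exp_eq
  simpa [hz] using h3

/-- Uniform concentrations work: neutrality is the solvability condition for Gauss' law. -/
theorem nonempty_XPos (hh : 0 < P.h) (hmass : ∀ s, 0 < P.mass s) (hneutral : P.Neutral) :
    P.XPos.Nonempty := by
  set n : ℝ := (Fintype.card (Grid N) : ℝ) with hn
  have hnpos : 0 < n := Nat.cast_pos.2 Fintype.card_pos
  set c : Fin M → Grid N → ℝ := fun s _ => P.mass s / (P.h ^ 3 * n) with hc
  have hpos : ∀ s p, 0 < c s p := fun s _ => div_pos (hmass s) (by positivity)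
  have hsum : ∑ p, (P.rho p + ∑ s, P.q s * c s p) = 0 := by
    have h1 : ∑ _p : Grid N, ∑ s, P.q s * (P.mass s / (P.h ^ 3 * n)) =
        (∑ s, P.q s * P.mass s) / P.h ^ 3 := by
      rw [Finset.sum_const, nsmul_eq_mul, Finset.card_univ, Finset.mul_sum, Finset.sum_div]
      refine Finset.sum_congr rfl fun s _ => ?_
      rw [← hn]
      field_simp
    have h2 : ∑ s, P.q s * P.mass s = -(P.h ^ 3 * ∑ p, P.rho p) :=
      eq_neg_of_add_eq_zero_left hneutral
    rw [Finset.sum_add_distrib, h1, h2]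
    field_simp
    ring
  obtain ⟨D, hD⟩ := exists_div_eq hh hsum
  refine ⟨(c, D), ⟨fun s p => (hpos s p).le, fun s => ?_, fun p => congrFun hD p⟩, hpos⟩
  simp only [hc, Finset.sum_const, nsmul_eq_mul, Finset.card_univ]
  rw [← hn]
  field_simp

theorem iter_mem_sublevel (hh : 0 < P.h) (heps : ∀ p, 0 < P.eps p) {x₀ : State M N}
    (hx : x₀ ∈ P.XPos) (t : ℕ) :
    P.iter x₀ t ∈ {x | x ∈ P.X ∧ P.energy x ≤ P.energy x₀} := by
  have h0 : P.iter x₀ 0 = x₀ := rfl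
  have h1 : P.energy (P.iter x₀ t) ≤ P.energy (P.iter x₀ 0) :=
    antitone_energy_iter hh heps hx (Nat.zero_le t)
  rw [h0] at h1
  exact ⟨(iter_mem_XPos hh heps hx t).1, h1⟩

/-- The algorithm supplies existence: its iterates stay in a compact sublevel set and so have a
cluster point. -/
theorem exists_isEquilibrium (hh : 0 < P.h) (heps : ∀ p, 0 < P.eps p) (hq : ∀ s, P.q s ≠ 0)
    (hmass : ∀ s, 0 < P.mass s) (hneutral : P.Neutral) : ∃ x ∈ P.X, P.IsEquilibrium x := by
  obtain ⟨x₀, hx₀⟩ := nonempty_XPos hh hmass hneutral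
  obtain ⟨x, hx, hcl⟩ := (isCompact_sublevel hh heps (P.energy x₀)).exists_mapClusterPt
    (f := atTop) (u := P.iter x₀)
    (tendsto_principal.2 (Eventually.of_forall (iter_mem_sublevel hh heps hx₀)))
  exact ⟨x, hx.1, isEquilibrium_of_mapClusterPt hh heps hq hx₀ hcl⟩

theorem IsEquilibrium.unique [NeZero M] (hh : 0 < P.h) (hq : ∀ s, P.q s ≠ 0)
    (hmass : ∀ s, 0 < P.mass s) (heps : ∀ p, 0 < P.eps p) {x y : State M N}
    (hx : P.IsEquilibrium x) (hy : P.IsEquilibrium y) (hX : x ∈ P.X) (hY : y ∈ P.X) : y = x := by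
  by_contra hne
  exact lt_asymm (hx.energy_lt hh hq hmass heps hX hY hne)
    (hy.energy_lt hh hq hmass heps hY hX (Ne.symm hne))

end Sweep

end Data

end PBLocal

theorem theoremt {M N : ℕ} [NeZero M] [NeZero N] (P : PBLocal.Data M N)
    (hL : 0 < P.L) (hq : ∀ s, P.q s ≠ 0) (hmass : ∀ s, 0 < P.mass s)
    (heps : ∀ p, 0 < P.eps p) (hneutral : P.Neutral) :
    ∃ xmin ∈ P.X, (∀ y ∈ P.X, y ≠ xmin → P.energy xmin < P.energy y) ∧
      ∀ x₀ ∈ P.X, (∀ s p, 0 < x₀.1 s p) →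
        (∀ t, P.iter x₀ t ∈ P.X ∧ ∀ s p, 0 < (P.iter x₀ t).1 s p) ∧
        (∀ m, P.TerminatesAt x₀ m → P.iter x₀ m = xmin) ∧
        (P.RunsForever x₀ →
          Tendsto (fun t => P.iter x₀ t) atTop (𝓝 xmin) ∧
          Tendsto (fun t => P.energy (P.iter x₀ t)) atTop (𝓝 (P.energy xmin))) := by
  have hh := PBLocal.Data.h_pos hL
  obtain ⟨x, hX, hx⟩ := PBLocal.Data.exists_isEquilibrium hh heps hq hmass hneutral
  refine ⟨x, hX, fun y hY hne => hx.energy_lt hh hq hmass heps hX hY hne, fun x₀ hx₀ hpos => ?_⟩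
  have hx₀' : x₀ ∈ P.XPos := ⟨hx₀, hpos⟩
  refine ⟨PBLocal.Data.iter_mem_XPos hh heps hx₀', fun m hm => ?_, fun _ => ?_⟩
  · have hm' := PBLocal.Data.iter_mem_XPos hh heps hx₀' m
    exact hx.unique hh hq hmass heps
      (PBLocal.Data.isEquilibrium_of_stops hh heps hq hm' hm.1) hX hm'.1
  · have hlim : Tendsto (fun t => P.iter x₀ t) atTop (𝓝 x) := by
      -- In a compact set, a sequence with only one possible cluster point converges to it.
      refine (PBLocal.Data.isCompact_sublevel hh heps
        (P.energy x₀)).tendsto_nhds_of_unique_mapClusterPt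
        (Eventually.of_forall (PBLocal.Data.iter_mem_sublevel hh heps hx₀')) fun y hy hcl => ?_
      exact hx.unique hh hq hmass heps
        (PBLocal.Data.isEquilibrium_of_mapClusterPt hh heps hq hx₀' hcl) hX hy.1
    exact ⟨hlim, (PBLocal.Data.continuous_energy.tendsto x).comp hlim⟩
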